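/- Let $d\ge 2$ be an integer, $r\in(0,1]$ and $q\ge 1$ a real number. Let $\mathcal K^{(1)}_{r,d}$ be the class of all convex bodies $K\subset\mathbb R^d$ (compact convex sets of positive volume) that are contained in the closed Euclidean unit ball centred at the origin and satisfy the $r$-rolling condition: for every $x\in\partial K$ there is a closed Euclidean ball $B$ of radius $r$ with $x\in B\subseteq K$. For $K\in\mathcal K^{(1)}_{r,d}$, the surface area $\mathcal H^{d-1}(\partial K)$ is positive and finite, so that the uniform distribution on $\partial K$, $\sigma_K=\mathcal H^{d-1}(\,\cdot\cap\partial K)/\mathcal H^{d-1}(\partial K)$, is a probability measure ($\mathcal H^{d-1}$ is the $(d-1)$-dimensional Hausdorff measure). Let $X_1,\dots,X_n$ be independent random points with law $\sigma_K$, let $\widehat K_n=\mathrm{conv}\{X_1,\dots,X_n\}$, let $\mathbb E_{\partial K}$ denote the corresponding expectation, and let $d_H$ be the Hausdorff distance for the Euclidean metric. Then there is a constant $C>0$, depending only on $d$, $r$ and $q$, such that for all integers $n\ge 2$ $$\sup_{K\in\mathcal K^{(1)}_{r,d}}\mathbb E_{\partial K}\bigl[d_H(\widehat K_n,K)^q\bigr]\le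 C\left(\frac{\ln n}{n}\right)^{\frac{2q}{d-1}}.$$ -/

import Mathlib

open MeasureTheory ProbabilityTheory
open scoped ENNReal

noncomputable section

/-- The `r`-rolling condition: through every boundary point of `K` there passes a closed
Euclidean ball of radius `r` that is contained in `K`. -/
def RollingCondition {d : ℕ} (r : ℝ) (K : Set (EuclideanSpace ℝ (Fin d))) : Prop :=
  ∀ x ∈ frontier K, ∃ c : EuclideanSpace ℝ (Fin d),
    x ∈ Metric.closedBall c r ∧ Metric.closedBall c r ⊆ K

/-- The class of convex bodies (compact, convex, of positive volume) in `ℝ^d` that are contained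
in the closed unit ball centred at the origin and satisfy the `r`-rolling condition. -/
def rollingBodies (r : ℝ) (d : ℕ) : Set (ConvexBody (EuclideanSpace ℝ (Fin d))) :=
  {K | 0 < volume (K : Set (EuclideanSpace ℝ (Fin d))) ∧
    (K : Set (EuclideanSpace ℝ (Fin d))) ⊆ Metric.closedBall 0 1 ∧
    RollingCondition r (K : Set (EuclideanSpace ℝ (Fin d)))}

/-- The uniform probability measure on the boundary of `K`: the surface area measure, i.e. the
`(d-1)`-dimensional Hausdorff measure, restricted to the boundary of `K` and divided by the
surface area of the boundary. (The normalising constant of the Hausdorff measure cancels.) -/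
def uniformBoundary {d : ℕ} (K : Set (EuclideanSpace ℝ (Fin d))) :
    Measure (EuclideanSpace ℝ (Fin d)) :=
  ProbabilityTheory.cond (Measure.hausdorffMeasure ((d : ℝ) - 1)) (frontier K)

/-- The random polytope: the convex hull of the points `X 0, …, X (n-1)`. -/
def randomPolytope {d n : ℕ} (X : Fin n → EuclideanSpace ℝ (Fin d)) :
    Set (EuclideanSpace ℝ (Fin d)) :=
  convexHull ℝ (Set.range X)

/-- The `q`-th moment of the Hausdorff distance between the random polytope and `K`, where the
`n` points are independent and uniformly distributed on the boundary of `K`. -/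
def boundaryMoment {d : ℕ} (K : Set (EuclideanSpace ℝ (Fin d))) (n : ℕ) (q : ℝ) : ℝ≥0∞ :=
  ∫⁻ X : Fin n → EuclideanSpace ℝ (Fin d),
    ENNReal.ofReal (Metric.hausdorffDist (randomPolytope X) K ^ q)
    ∂(Measure.pi fun _ : Fin n => uniformBoundary K)

end

/-! Write `d = m + 1`. Every cap of `K` of depth `t ≤ r` has `uniformBoundary` measure at least a
constant times `t ^ (m / 2)`, uniformly over the class. Two bounds give this. The rolling ball at
the tip of the cap makes the projection of the cap along its normal contain an `m`-cube of side of
order `√(r t)` (`hausdorffMeasure_cap_ge`). The total surface area is at most that of the cube `[-1,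
1] ^ d`, because pushing `∂K` outwards along normals is expanding
(`hausdorffMeasure_frontier_le_cubeBoundary`).

If the Hausdorff distance exceeds `t`, some cap of depth `t` contains no sample point. A finite net
of directions reduces this to polynomially many caps of depth `t / 2`, and a union bound applies
(`boundaryMoment_le`). With `t ^ (m / 2) = B ln n / n` and `B` large, the failure probability is a
negative power of `n` that is negligible against `t ^ q` (`rate_bounds`). -/

/-! ### Upper bound for the surface area. -/

/-- The boundary of the cube `[-1, 1] ^ (m + 1)`. -/
def cubeBoundary (m : ℕ) : Set (EuclideanSpace ℝ (Fin (m + 1))) :=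
  {y | (∀ i, |y i| ≤ 1) ∧ ∃ i, |y i| = 1}

/-- The affine parametrisation of a coordinate hyperplane. -/
def faceMap (m : ℕ) (i : Fin (m + 1)) (s : ℝ) (z : Fin m → ℝ) : EuclideanSpace ℝ (Fin (m + 1)) :=
  WithLp.toLp 2 (i.insertNth (α := fun _ => ℝ) s z)

theorem lipschitzWith_faceMap (m : ℕ) (i : Fin (m + 1)) (s : ℝ) :
    ∃ C, LipschitzWith C (faceMap m i s) := by
  have h : LipschitzWith 1 (fun z : Fin m → ℝ => i.insertNth (α := fun _ => ℝ) s z) := by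
    refine LipschitzWith.of_dist_le_mul fun z w => ?_
    rw [NNReal.coe_one, one_mul, dist_pi_le_iff dist_nonneg, Fin.forall_iff_succAbove i]
    simpa using fun j => dist_le_pi_dist z w j
  exact ⟨_, (PiLp.lipschitzWith_toLp 2 (fun _ : Fin (m + 1) => ℝ)).comp h⟩

theorem hausdorffMeasure_cubeBoundary_lt_top (m : ℕ) :
    Measure.hausdorffMeasure (m : ℝ) (cubeBoundary m) < ∞ := by
  have hvol : (Measure.hausdorffMeasure (m : ℝ) : Measure (Fin m → ℝ)) = volume := by
    simpa using hausdorffMeasure_pi_real (ι := Fin m)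
  have hsub : cubeBoundary m ⊆ ⋃ i : Fin (m + 1), (faceMap m i 1 '' Metric.closedBall 0 1 ∪
      faceMap m i (-1) '' Metric.closedBall 0 1) := by
    rintro y ⟨hy, i, hi⟩
    refine Set.mem_iUnion.2 ⟨i, ?_⟩
    have hz : i.removeNth (α := fun _ => ℝ) (fun j => y j) ∈
        Metric.closedBall (0 : Fin m → ℝ) 1 := by
      rw [mem_closedBall_zero_iff, pi_norm_le_iff_of_nonneg zero_le_one]
      exact fun j => hy _
    have hface : faceMap m i (y i) (i.removeNth (α := fun _ => ℝ) (fun j => y j)) = y := by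
      ext j
      simp [faceMap]
    rcases eq_or_eq_neg_of_abs_eq hi with h | h
    · exact Or.inl ⟨_, hz, h ▸ hface⟩
    · exact Or.inr ⟨_, hz, h ▸ hface⟩
  have hface : ∀ i s, Measure.hausdorffMeasure (m : ℝ)
      (faceMap m i s '' Metric.closedBall 0 1) < ∞ := by
    intro i s
    obtain ⟨C, hC⟩ := lipschitzWith_faceMap m i s
    refine (hC.hausdorffMeasure_image_le m.cast_nonneg _).trans_lt ?_
    rw [hvol]
    exact ENNReal.mul_lt_top (ENNReal.rpow_lt_top_of_nonneg m.cast_nonneg ENNReal.coe_ne_top)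
      measure_closedBall_lt_top
  refine (measure_mono hsub).trans_lt ((measure_iUnion_le _).trans_lt ?_)
  rw [tsum_fintype]
  refine ENNReal.sum_lt_top.2 fun i _ => ?_
  exact (measure_union_le _ _).trans_lt (ENNReal.add_lt_top.2 ⟨hface i 1, hface i (-1)⟩)

theorem exists_ray_mem_cubeBoundary {m : ℕ} {x u : EuclideanSpace ℝ (Fin (m + 1))}
    (hx : ‖x‖ ≤ 1) (hu : ‖u‖ = 1) : ∃ s : ℝ, 0 ≤ s ∧ x + s • u ∈ cubeBoundary m := by
  have hxi : ∀ i, |x i| ≤ 1 := fun i => (PiLp.norm_apply_le x i).trans hx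
  obtain ⟨i, hi⟩ : ∃ i, u i ≠ 0 := by
    by_contra! h
    have : u = 0 := by ext i; simpa using h i
    simp [this] at hu
  let f : ℝ → ℝ := fun s => ‖(fun j => x j + s * u j : Fin (m + 1) → ℝ)‖
  have hf : Continuous f := by fun_prop
  have h0 : f 0 ≤ 1 := by
    simp only [f]
    rw [pi_norm_le_iff_of_nonneg zero_le_one]
    simpa using hxi
  have hS : 0 ≤ 2 / |u i| := by positivity
  -- At `s = 2 / |u i|` coordinate `i` has moved by 2, starting from absolute value at most 1.
  have h1 : 1 ≤ f (2 / |u i|) := by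
    refine le_trans ?_ (norm_le_pi_norm (fun j => x j + 2 / |u i| * u j : Fin (m + 1) → ℝ) i)
    have h2 : |2 / |u i| * u i| = 2 := by
      rw [abs_mul, abs_div, abs_abs, div_mul_cancel₀ _ (abs_pos.2 hi).ne']; norm_num
    have h3 := abs_sub_abs_le_abs_sub (2 / |u i| * u i) (-x i)
    rw [h2, abs_neg, sub_neg_eq_add] at h3
    rw [Real.norm_eq_abs, add_comm (x i)]
    linarith [hxi i]
  obtain ⟨s, hs, hfs⟩ := intermediate_value_Icc hS hf.continuousOn ⟨h0, h1⟩
  refine ⟨s, hs.1, fun j => ?_, ?_⟩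
  · have := norm_le_pi_norm (fun j => x j + s * u j : Fin (m + 1) → ℝ) j
    simpa [f] using this.trans hfs.le
  · by_contra! h
    have hlt : ∀ j, ‖x j + s * u j‖ < 1 := fun j => by
      have := norm_le_pi_norm (fun j => x j + s * u j : Fin (m + 1) → ℝ) j
      exact lt_of_le_of_ne (this.trans hfs.le) (by simpa using h j)
    exact absurd hfs ((pi_norm_lt_iff zero_lt_one).2 hlt).ne

theorem Convex.exists_unit_normal {E : Type*} [NormedAddCommGroup E] [InnerProductSpace ℝ E]
    [CompleteSpace E] {K : Set E} (hK : Convex ℝ K) (hint : (interior K).Nonempty) {x : E}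
    (hx : x ∈ frontier K) : ∃ u : E, ‖u‖ = 1 ∧ ∀ y ∈ K, inner ℝ u y ≤ inner ℝ u x := by
  obtain ⟨f, hf⟩ := geometric_hahn_banach_open_point hK.interior isOpen_interior hx.2
  set v := (InnerProductSpace.toDual ℝ E).symm f
  have hv : ∀ y, inner ℝ v y = f y := fun y => InnerProductSpace.toDual_symm_apply
  have hle : ∀ y ∈ K, f y ≤ f x := by
    intro y hy
    have hcl : closure (interior K) ⊆ {z | f z ≤ f x} :=
      closure_minimal (fun z hz => (hf z hz).le) (isClosed_le f.continuous continuous_const)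
    exact hcl (hK.closure_interior_eq_closure_of_nonempty_interior hint ▸ subset_closure hy)
  have hv0 : v ≠ 0 := by
    intro h
    obtain ⟨z, hz⟩ := hint
    have := hf z hz
    rw [← hv, ← hv, h] at this
    simp at this
  refine ⟨‖v‖⁻¹ • v, by simp [norm_smul, hv0], fun y hy => ?_⟩
  rw [real_inner_smul_left, real_inner_smul_left, hv, hv]
  exact mul_le_mul_of_nonneg_left (hle y hy) (by positivity)

/-- Moving two points along outer normals does not bring them closer. -/
theorem norm_sub_le_of_normals {E : Type*} [NormedAddCommGroup E] [InnerProductSpace ℝ E]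
    {x y u v : E} {s t : ℝ} (hs : 0 ≤ s) (ht : 0 ≤ t) (hu : inner ℝ u y ≤ inner ℝ u x)
    (hv : inner ℝ v x ≤ inner ℝ v y) : ‖x - y‖ ≤ ‖(x + s • u) - (y + t • v)‖ := by
  -- The normal conditions say that `u` and `-v` have nonnegative inner product with `x - y`;
  -- Cauchy–Schwarz then finishes.
  have h : ‖x - y‖ ^ 2 ≤ inner ℝ ((x + s • u) - (y + t • v)) (x - y) := by
    have : (x + s • u) - (y + t • v) = (x - y) + (s • u - t • v) := by abel
    rw [this, inner_add_left, real_inner_self_eq_norm_sq, inner_sub_left, real_inner_smul_left,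
      real_inner_smul_left, inner_sub_right, inner_sub_right]
    nlinarith
  have h2 := real_inner_le_norm ((x + s • u) - (y + t • v)) (x - y)
  rcases (norm_nonneg (x - y)).eq_or_lt with h0 | h0
  · rw [← h0]; positivity
  · nlinarith

/-- Each boundary point is sent along a chosen outer normal to the cube boundary. The map does not
decrease distances, so its inverse is 1-Lipschitz and maps a subset of the cube boundary onto `∂K`.
No regularity of the choice of normals is needed. -/
theorem hausdorffMeasure_frontier_le_cubeBoundary {m : ℕ}
    {K : Set (EuclideanSpace ℝ (Fin (m + 1)))} (hK : Convex ℝ K) (hcl : IsClosed K)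
    (hint : (interior K).Nonempty) (hball : K ⊆ Metric.closedBall 0 1) :
    Measure.hausdorffMeasure (m : ℝ) (frontier K) ≤
      Measure.hausdorffMeasure (m : ℝ) (cubeBoundary m) := by
  have hex : ∀ x : EuclideanSpace ℝ (Fin (m + 1)), ∃ u : EuclideanSpace ℝ (Fin (m + 1)), ∃ s : ℝ,
      x ∈ frontier K → (∀ y ∈ K, inner ℝ u y ≤ inner ℝ u x) ∧ 0 ≤ s ∧
        x + s • u ∈ cubeBoundary m := by
    intro x
    by_cases hx : x ∈ frontier K
    · obtain ⟨u, hu, hux⟩ := hK.exists_unit_normal hint hx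
      obtain ⟨s, hs, hsx⟩ := exists_ray_mem_cubeBoundary
        (mem_closedBall_zero_iff.1 (hball (hcl.frontier_subset hx))) hu
      exact ⟨u, s, fun _ => ⟨hux, hs, hsx⟩⟩
    · exact ⟨0, 0, fun h => absurd h hx⟩
  choose u s hus using hex
  let f : EuclideanSpace ℝ (Fin (m + 1)) → EuclideanSpace ℝ (Fin (m + 1)) :=
    fun x => x + s x • u x
  have hf : ∀ x ∈ frontier K, ∀ y ∈ frontier K, ‖x - y‖ ≤ ‖f x - f y‖ := fun x hx y hy =>
    norm_sub_le_of_normals (hus x hx).2.1 (hus y hy).2.1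
      ((hus x hx).1 y (hcl.frontier_subset hy)) ((hus y hy).1 x (hcl.frontier_subset hx))
  have hinj : Set.InjOn f (frontier K) := fun x hx y hy hxy => by
    have := hf x hx y hy
    rw [hxy, sub_self, norm_zero] at this
    exact sub_eq_zero.1 (norm_le_zero_iff.1 this)
  have hg : LipschitzOnWith 1 (Function.invFunOn f (frontier K)) (f '' frontier K) := by
    refine LipschitzOnWith.of_dist_le_mul ?_
    rintro _ ⟨x, hx, rfl⟩ _ ⟨y, hy, rfl⟩
    rw [hinj.leftInvOn_invFunOn hx, hinj.leftInvOn_invFunOn hy, NNReal.coe_one, one_mul,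
      dist_eq_norm, dist_eq_norm]
    exact hf x hx y hy
  have himg := hg.hausdorffMeasure_image_le (d := m) m.cast_nonneg
  rw [hinj.invFunOn_image subset_rfl, ENNReal.coe_one, ENNReal.one_rpow, one_mul] at himg
  refine himg.trans (measure_mono ?_)
  rintro _ ⟨x, hx, rfl⟩
  exact (hus x hx).2.2

/-! ### Lower bound for the surface area of caps. -/

theorem IsCompact.exists_mem_frontier_ray {E : Type*} [NormedAddCommGroup E]
    [InnerProductSpace ℝ E] {K : Set E} (hK : IsCompact K) {u z : E} (hu : ‖u‖ = 1) (hz : z ∈ K) :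
    ∃ s : ℝ, 0 ≤ s ∧ z + s • u ∈ frontier K := by
  have hc : IsCompact (K ∩ {y | ∃ s : ℝ, 0 ≤ s ∧ y = z + s • u}) := by
    refine hK.inter_right ?_
    have hiso : Isometry fun s : ℝ => z + s • u := by
      refine Isometry.of_dist_eq fun s t => ?_
      rw [dist_add_left, dist_eq_norm, ← sub_smul, norm_smul, hu, mul_one, dist_eq_norm]
    have : {y | ∃ s : ℝ, 0 ≤ s ∧ y = z + s • u} = (fun s : ℝ => z + s • u) '' Set.Ici 0 := by
      ext y
      simp [eq_comm]
    rw [this]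
    exact hiso.isClosedEmbedding.isClosedMap _ isClosed_Ici
  obtain ⟨y, ⟨hyK, s, hs, rfl⟩, hmax⟩ := hc.exists_isMaxOn ⟨z, hz, 0, le_rfl, by simp⟩
    (f := fun y => inner ℝ u y) (by fun_prop)
  refine ⟨s, hs, subset_closure hyK, fun hint => ?_⟩
  obtain ⟨ε, hε, hball⟩ := Metric.isOpen_iff.1 isOpen_interior _ hint
  have hmem : z + (s + ε / 2) • u ∈ K := by
    refine interior_subset (hball ?_)
    rw [Metric.mem_ball, dist_add_left, dist_eq_norm, ← sub_smul, norm_smul, hu, mul_one,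
      add_sub_cancel_left, Real.norm_of_nonneg (by positivity)]
    linarith
  have h := hmax (a := z + (s + ε / 2) • u) ⟨hmem, _, by positivity, rfl⟩
  simp only [Set.mem_ofPred_eq, inner_add_right, real_inner_smul_right,
    real_inner_self_eq_norm_sq, hu] at h
  linarith

theorem mem_frontier_of_inner_le {E : Type*} [NormedAddCommGroup E] [InnerProductSpace ℝ E]
    {K : Set E} {u x : E} (hu : ‖u‖ = 1) (hx : x ∈ K) (hmax : ∀ y ∈ K, inner ℝ u y ≤ inner ℝ u x) :
    x ∈ frontier K := by
  refine ⟨subset_closure hx, fun hint => ?_⟩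
  obtain ⟨ε, hε, hball⟩ := Metric.isOpen_iff.1 isOpen_interior _ hint
  have h := hmax (x + (ε / 2) • u) (interior_subset (hball (by
    rw [Metric.mem_ball, dist_self_add_left, norm_smul, hu, mul_one,
      Real.norm_of_nonneg (by positivity)]
    linarith)))
  simp only [inner_add_right, real_inner_smul_right, real_inner_self_eq_norm_sq, hu] at h
  linarith

/-- Above every point close to the axis of a ball contained in `K` and touching the supporting
hyperplane there is a boundary point of `K` in the cap. -/
theorem exists_mem_frontier_cap {E : Type*} [NormedAddCommGroup E] [InnerProductSpace ℝ E]
    {K : Set E} (hK : IsCompact K) {r t : ℝ} (hr : 0 < r) {c u x p : E} (hu : ‖u‖ = 1)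
    (hball : Metric.closedBall c r ⊆ K) (hxc : x ∈ Metric.closedBall c r)
    (hp : inner ℝ u p = 0)
    (hpr : ‖p‖ ^ 2 ≤ r ^ 2) (hpt : ‖p‖ ^ 2 < r * t) :
    ∃ s : ℝ, c + p + s • u ∈ frontier K ∧ inner ℝ u x - t < inner ℝ u (c + p + s • u) := by
  have hcu : inner ℝ u x ≤ inner ℝ u c + r := by
    have h := real_inner_le_norm u (x - c)
    rw [hu, one_mul, inner_sub_right, ← dist_eq_norm] at h
    linarith [Metric.mem_closedBall.1 hxc]
  -- The height `r - ‖p‖ ^ 2 / r` is a rational lower bound for the height `√(r ^ 2 - ‖p‖ ^ 2)` of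
  -- the sphere over `p`.
  have hz : c + p + (r - ‖p‖ ^ 2 / r) • u ∈ K := by
    refine hball ?_
    rw [Metric.mem_closedBall, dist_eq_norm, add_assoc, add_sub_cancel_left]
    refine (sq_le_sq₀ (by positivity) (by positivity)).1 ?_
    rw [norm_add_sq_real, real_inner_smul_right, real_inner_comm, hp, norm_smul, hu, mul_one,
      Real.norm_eq_abs, sq_abs]
    have h1 : (‖p‖ ^ 2 / r) * r = ‖p‖ ^ 2 := div_mul_cancel₀ _ hr.ne'
    have h2 : 0 ≤ ‖p‖ ^ 2 / r := by positivity
    have h3 : ‖p‖ ^ 2 / r ≤ r := by rw [div_le_iff₀ hr]; nlinarith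
    nlinarith
  obtain ⟨s, hs, hfr⟩ := hK.exists_mem_frontier_ray hu hz
  refine ⟨r - ‖p‖ ^ 2 / r + s, ?_, ?_⟩
  · rwa [add_smul, ← add_assoc]
  · have h3 : ‖p‖ ^ 2 / r < t := by rw [div_lt_iff₀ hr]; linarith
    rw [inner_add_right, inner_add_right, real_inner_smul_right, hp, real_inner_self_eq_norm_sq, hu]
    linarith

/-- Orthonormal coordinates on the hyperplane orthogonal to `u` give a 1-Lipschitz map to `Fin m →
ℝ` with the sup metric, where Hausdorff measure is Lebesgue measure. The image of the cap covers the
cube of half-side `ρ`, whose points have squared Euclidean norm at most `m * ρ ^ 2`. -/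
theorem hausdorffMeasure_cap_ge {m : ℕ} {K : Set (EuclideanSpace ℝ (Fin (m + 1)))}
    (hK : IsCompact K) {r t ρ : ℝ} (hr : 0 < r) (hroll : RollingCondition r K)
    {u x : EuclideanSpace ℝ (Fin (m + 1))} (hu : ‖u‖ = 1) (hx : x ∈ K)
    (hmax : ∀ y ∈ K, inner ℝ u y ≤ inner ℝ u x) (hρ : 0 ≤ ρ)
    (hρr : m * ρ ^ 2 ≤ r ^ 2) (hρt : m * ρ ^ 2 < r * t) :
    ENNReal.ofReal ((2 * ρ) ^ m) ≤ Measure.hausdorffMeasure (m : ℝ)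
      (frontier K ∩ {y | inner ℝ u x - t < inner ℝ u y}) := by
  obtain ⟨c, hxc, hball⟩ := hroll x (mem_frontier_of_inner_le hu hx hmax)
  have : Fact (Module.finrank ℝ (EuclideanSpace ℝ (Fin (m + 1))) = m + 1) := ⟨by simp⟩
  have hu0 : u ≠ 0 := by rintro rfl; simp at hu
  let b := OrthonormalBasis.fromOrthogonalSpanSingleton (𝕜 := ℝ) m hu0
  have hub : ∀ w : (Submodule.span ℝ {u})ᗮ, inner ℝ u (w : EuclideanSpace ℝ (Fin (m + 1))) = 0 :=
    fun w => Submodule.mem_orthogonal_singleton_iff_inner_right.1 w.2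
  let π : EuclideanSpace ℝ (Fin (m + 1)) → Fin m → ℝ :=
    fun y i => inner ℝ (b i : EuclideanSpace ℝ (Fin (m + 1))) y
  have hb1 : ∀ i, ‖(b i : EuclideanSpace ℝ (Fin (m + 1)))‖ = 1 := fun i => by
    exact b.orthonormal.1 i
  have hπ : LipschitzWith 1 π := by
    refine LipschitzWith.of_dist_le_mul fun y z => ?_
    rw [NNReal.coe_one, one_mul, dist_pi_le_iff dist_nonneg]
    intro i
    rw [Real.dist_eq, ← inner_sub_right, dist_eq_norm]
    simpa [hb1] using abs_real_inner_le_norm (b i : EuclideanSpace ℝ (Fin (m + 1))) (y - z)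
  have hvol : (Measure.hausdorffMeasure (m : ℝ) : Measure (Fin m → ℝ)) = volume := by
    simpa using hausdorffMeasure_pi_real (ι := Fin m)
  have himg := hπ.hausdorffMeasure_image_le (d := m) m.cast_nonneg
    (frontier K ∩ {y | inner ℝ u x - t < inner ℝ u y})
  rw [ENNReal.coe_one, ENNReal.one_rpow, one_mul, hvol] at himg
  refine le_trans ?_ himg
  have hv := Real.volume_pi_closedBall (π c) hρ
  rw [Fintype.card_fin] at hv
  rw [← hv]
  refine measure_mono fun y hy => ?_
  let w : (Submodule.span ℝ {u})ᗮ := b.repr.symm (WithLp.toLp 2 (y - π c))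
  have hw : ‖(w : EuclideanSpace ℝ (Fin (m + 1)))‖ ^ 2 ≤ m * ρ ^ 2 := by
    rw [← Submodule.coe_norm, LinearIsometryEquiv.norm_map, EuclideanSpace.norm_sq_eq]
    have hle : ∀ i ∈ (Finset.univ : Finset (Fin m)), ‖(y - π c) i‖ ^ 2 ≤ ρ ^ 2 := fun i _ => by
      have h1 := norm_le_pi_norm (y - π c) i
      rw [Metric.mem_closedBall, dist_eq_norm] at hy
      gcongr
      exact h1.trans hy
    simpa using Finset.sum_le_sum hle
  obtain ⟨s, hs, hlt⟩ := exists_mem_frontier_cap hK hr hu hball hxc (hub w)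
    (hw.trans hρr) (hw.trans_lt hρt)
  refine ⟨_, ⟨hs, hlt⟩, ?_⟩
  ext i
  have h1 : inner ℝ (b i : EuclideanSpace ℝ (Fin (m + 1))) u = 0 := by
    rw [real_inner_comm]; exact hub _
  have h2 : inner ℝ (b i : EuclideanSpace ℝ (Fin (m + 1))) (w : EuclideanSpace ℝ (Fin (m + 1)))
      = y i - π c i := by
    rw [← Submodule.coe_inner, ← b.repr_apply_apply]
    simp [w]
  change inner ℝ (b i : EuclideanSpace ℝ (Fin (m + 1))) (c + w + s • u) = y i
  rw [inner_add_right, inner_add_right, real_inner_smul_right, h1, h2]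
  simp [π]

/-! ### Empty caps and nets of directions. -/

/-- If the convex hull of finitely many points of `K` is far from `K`, then some cap of `K`
misses all points. -/
theorem exists_cap_of_lt_hausdorffDist {d n : ℕ} [NeZero n] {K : Set (EuclideanSpace ℝ (Fin d))}
    (hK : Convex ℝ K) {t : ℝ} (ht : 0 ≤ t) {X : Fin n → EuclideanSpace ℝ (Fin d)}
    (hX : ∀ i, X i ∈ K) (hlt : t < Metric.hausdorffDist (randomPolytope X) K) :
    ∃ u : EuclideanSpace ℝ (Fin d), ‖u‖ = 1 ∧ ∃ x ∈ K, ∀ i, inner ℝ u (X i) < inner ℝ u x - t := by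
  by_contra! hcon
  refine absurd hlt (not_lt.2 (Metric.hausdorffDist_le_of_mem_dist ht ?_ ?_))
  · intro x hx
    refine ⟨x, convexHull_min ?_ hK hx, by simpa using ht⟩
    rintro _ ⟨i, rfl⟩
    exact hX i
  · intro x hx
    have hcomp : IsCompact (randomPolytope X) := (Set.finite_range X).isCompact_convexHull ℝ
    have hconv : Convex ℝ (randomPolytope X) := convex_convexHull ℝ _
    have hmem : ∀ i, X i ∈ randomPolytope X := fun i => subset_convexHull ℝ _ ⟨i, rfl⟩
    obtain ⟨y, hy, hxy⟩ := exists_norm_eq_iInf_of_complete_convex ⟨_, hmem 0⟩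
      hcomp.isComplete hconv x
    refine ⟨y, hy, ?_⟩
    by_contra! hd
    rw [norm_eq_iInf_iff_real_inner_le_zero hconv hy] at hxy
    rw [dist_eq_norm] at hd
    have hpos : 0 < ‖x - y‖ := ht.trans_lt hd
    -- In the direction from the nearest point `y` to `x`, every sample point lies at least `‖x - y‖
    -- > t` below `x`.
    obtain ⟨i, hi⟩ := hcon (‖x - y‖⁻¹ • (x - y)) (by
      rw [norm_smul, norm_inv, norm_norm, inv_mul_cancel₀ hpos.ne']) x hx
    have h1 := hxy _ (hmem i)
    have h2 : inner ℝ (x - y) (x - X i) = ‖x - y‖ ^ 2 - inner ℝ (x - y) (X i - y) := by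
      rw [← real_inner_self_eq_norm_sq, ← inner_sub_right]
      congr 1
      abel
    rw [sub_le_comm, ← inner_sub_right, real_inner_smul_left, h2, inv_mul_le_iff₀ hpos] at hi
    nlinarith

/-- Unit vectors with equal values of all `⌊M * u i⌋` differ by less than `1 / M` in each
coordinate. One unit vector is picked per cell, so the net itself lies on the sphere; empty cells
get an arbitrary one. -/
theorem exists_finset_net_sphere (d M : ℕ) (hd : 0 < d) (hM : 0 < M) :
    ∃ s : Finset (EuclideanSpace ℝ (Fin d)), s.card ≤ (2 * M + 1) ^ d ∧ (∀ v ∈ s, ‖v‖ = 1) ∧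
      ∀ u : EuclideanSpace ℝ (Fin d), ‖u‖ = 1 → ∃ v ∈ s, ‖u - v‖ ≤ d / M := by
  classical
  let S := {u : EuclideanSpace ℝ (Fin d) // ‖u‖ = 1}
  have : Nonempty S := ⟨⟨EuclideanSpace.single ⟨0, hd⟩ 1, by simp⟩⟩
  have hM' : (0 : ℝ) < M := Nat.cast_pos.2 hM
  have habs : ∀ (u : S) i, |u.1 i| ≤ 1 := fun u i => (PiLp.norm_apply_le u.1 i).trans u.2.le
  let f : S → Fin d → Finset.Icc (-M : ℤ) M := fun u i => ⟨⌊M * u.1 i⌋, by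
    rw [Finset.mem_Icc]
    have := abs_le.1 (habs u i)
    constructor
    · rw [Int.le_floor]; push_cast; nlinarith
    · have h : (⌊M * u.1 i⌋ : ℝ) ≤ M := (Int.floor_le _).trans (by nlinarith)
      exact_mod_cast h⟩
  refine ⟨Finset.univ.image fun c => (Function.invFun f c).1, ?_, ?_, ?_⟩
  · refine Finset.card_image_le.trans (le_of_eq ?_)
    rw [Finset.card_univ, Fintype.card_fun, Fintype.card_fin, Fintype.card_coe, Int.card_Icc]
    congr 1
    omega
  · intro v hv
    obtain ⟨c, -, rfl⟩ := Finset.mem_image.1 hv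
    exact (Function.invFun f c).2
  · intro u hu
    set v := Function.invFun f (f ⟨u, hu⟩)
    have hv : f v = f ⟨u, hu⟩ := Function.invFun_eq ⟨_, rfl⟩
    refine ⟨v.1, Finset.mem_image.2 ⟨_, Finset.mem_univ _, rfl⟩, ?_⟩
    have hi : ∀ i, ‖(u - v.1) i‖ ≤ 1 / M := by
      intro i
      have h1 : ⌊M * v.1 i⌋ = ⌊M * u i⌋ := congrArg Subtype.val (congrFun hv i)
      have h2 := Int.abs_sub_lt_one_of_floor_eq_floor h1
      rw [← mul_sub, abs_mul, abs_of_pos hM', abs_sub_comm] at h2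
      rw [Real.norm_eq_abs, le_div_iff₀ hM', mul_comm]
      exact h2.le
    refine (sq_le_sq₀ (by positivity) (by positivity)).1 ?_
    rw [EuclideanSpace.norm_sq_eq]
    calc ∑ i, ‖(u - v.1) i‖ ^ 2 ≤ ∑ _i : Fin d, (1 / M : ℝ) ^ 2 :=
          Finset.sum_le_sum fun i _ => pow_le_pow_left₀ (norm_nonneg _) (hi i) 2
      _ = d * (1 / M : ℝ) ^ 2 := by simp
      _ ≤ (d / M : ℝ) ^ 2 := by
        rw [div_pow, div_pow, one_pow, mul_one_div]
        gcongr
        have : (1 : ℝ) ≤ d := by exact_mod_cast hd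
        nlinarith

/-! ### Uniform estimates over the class. -/

section rollingBodies

variable {m : ℕ} {r : ℝ} {K : ConvexBody (EuclideanSpace ℝ (Fin (m + 1)))}

theorem interior_nonempty_of_mem_rollingBodies (hK : K ∈ rollingBodies r (m + 1)) :
    (interior (K : Set (EuclideanSpace ℝ (Fin (m + 1))))).Nonempty := by
  by_contra! h
  refine hK.1.ne' (measure_mono_null (fun x hx => ?_) (K.convex.addHaar_frontier volume))
  exact ⟨subset_closure hx, by simp [h]⟩

theorem exists_inner_max (K : ConvexBody (EuclideanSpace ℝ (Fin (m + 1))))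
    (u : EuclideanSpace ℝ (Fin (m + 1))) :
    ∃ x ∈ K, ∀ y ∈ K, inner ℝ u y ≤ inner ℝ u x := by
  obtain ⟨x, hx, hmax⟩ := K.isCompact.exists_isMaxOn K.nonempty
    (f := fun y => inner ℝ u y) (by fun_prop)
  exact ⟨x, hx, fun y hy => hmax hy⟩

theorem hausdorffMeasure_cap_ge_sqrt (hm : 0 < m) (hr : 0 < r) (hK : K ∈ rollingBodies r (m + 1))
    {t : ℝ} (ht : 0 < t) (htr : t ≤ r) {u x : EuclideanSpace ℝ (Fin (m + 1))} (hu : ‖u‖ = 1)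
    (hx : x ∈ K) (hmax : ∀ y ∈ K, inner ℝ u y ≤ inner ℝ u x) :
    ENNReal.ofReal ((2 * √(r / (2 * m))) ^ m * √t ^ m) ≤ Measure.hausdorffMeasure (m : ℝ)
      (frontier (K : Set (EuclideanSpace ℝ (Fin (m + 1)))) ∩
        {y | inner ℝ u x - t < inner ℝ u y}) := by
  have hm' : (0 : ℝ) < m := Nat.cast_pos.2 hm
  -- With this half-side `ρ`, `m * ρ ^ 2 = r * t / 2` is below both `r ^ 2` and `r * t`.
  have hsq : (m : ℝ) * (√(r / (2 * m)) * √t) ^ 2 = r * t / 2 := by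
    rw [mul_pow, Real.sq_sqrt (by positivity), Real.sq_sqrt ht.le]
    field_simp
  rw [← mul_pow, mul_assoc]
  refine hausdorffMeasure_cap_ge K.isCompact hr hK.2.2 hu hx hmax (by positivity) ?_ ?_
  · rw [hsq]; nlinarith
  · rw [hsq]; nlinarith [mul_pos hr ht]

theorem hausdorffMeasure_frontier_pos (hm : 0 < m) (hr : 0 < r)
    (hK : K ∈ rollingBodies r (m + 1)) :
    0 < Measure.hausdorffMeasure (m : ℝ)
      (frontier (K : Set (EuclideanSpace ℝ (Fin (m + 1))))) := by
  have hm' : (0 : ℝ) < m := Nat.cast_pos.2 hm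
  obtain ⟨x, hx, hmax⟩ := exists_inner_max K (EuclideanSpace.single 0 1)
  refine lt_of_lt_of_le ?_ ((hausdorffMeasure_cap_ge_sqrt hm hr hK hr le_rfl (by simp) hx
    hmax).trans (measure_mono Set.inter_subset_left))
  rw [ENNReal.ofReal_pos]
  positivity

theorem hausdorffMeasure_frontier_le (hK : K ∈ rollingBodies r (m + 1)) :
    Measure.hausdorffMeasure (m : ℝ) (frontier (K : Set (EuclideanSpace ℝ (Fin (m + 1))))) ≤
      Measure.hausdorffMeasure (m : ℝ) (cubeBoundary m) :=
  hausdorffMeasure_frontier_le_cubeBoundary K.convex K.isClosed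
    (interior_nonempty_of_mem_rollingBodies hK) hK.2.1

theorem uniformBoundary_eq (K : Set (EuclideanSpace ℝ (Fin (m + 1)))) :
    uniformBoundary K = ProbabilityTheory.cond (Measure.hausdorffMeasure (m : ℝ)) (frontier K) := by
  rw [uniformBoundary]
  congr 2
  push_cast
  ring

theorem isProbabilityMeasure_uniformBoundary (hm : 0 < m) (hr : 0 < r)
    (hK : K ∈ rollingBodies r (m + 1)) :
    IsProbabilityMeasure (uniformBoundary (K : Set (EuclideanSpace ℝ (Fin (m + 1))))) := by
  rw [uniformBoundary_eq]
  exact cond_isProbabilityMeasure_of_finite (hausdorffMeasure_frontier_pos hm hr hK).ne'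
    ((hausdorffMeasure_frontier_le hK).trans_lt (hausdorffMeasure_cubeBoundary_lt_top m)).ne

theorem ae_mem_uniformBoundary {d : ℕ} (K : ConvexBody (EuclideanSpace ℝ (Fin d))) :
    ∀ᵐ x ∂uniformBoundary (K : Set (EuclideanSpace ℝ (Fin d))), x ∈ K :=
  (ae_cond_mem isClosed_frontier.measurableSet).mono fun _ hx => K.isClosed.frontier_subset hx

/-- The constant in the lower bound for the measure of caps. -/
noncomputable def capConst (m : ℕ) (r : ℝ) : ℝ :=
  (2 * √(r / (2 * m))) ^ m / ((Measure.hausdorffMeasure (m : ℝ) (cubeBoundary m)).toReal + 1)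

theorem capConst_pos (hm : 0 < m) (hr : 0 < r) : 0 < capConst m r := by
  have hm' : (0 : ℝ) < m := Nat.cast_pos.2 hm
  have : 0 ≤ (Measure.hausdorffMeasure (m : ℝ) (cubeBoundary m)).toReal := ENNReal.toReal_nonneg
  unfold capConst
  positivity

theorem uniformBoundary_cap_compl_le (hm : 0 < m) (hr : 0 < r)
    (hK : K ∈ rollingBodies r (m + 1)) {t : ℝ} (ht : 0 < t) (htr : t ≤ r)
    {u x : EuclideanSpace ℝ (Fin (m + 1))} (hu : ‖u‖ = 1)
    (hx : x ∈ K) (hmax : ∀ y ∈ K, inner ℝ u y ≤ inner ℝ u x) :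
    uniformBoundary (K : Set (EuclideanSpace ℝ (Fin (m + 1))))
      {y | inner ℝ u y ≤ inner ℝ u x - t} ≤
        ENNReal.ofReal (Real.exp (-(capConst m r * √t ^ m))) := by
  have := isProbabilityMeasure_uniformBoundary hm hr hK
  set H := (Measure.hausdorffMeasure (m : ℝ) (cubeBoundary m)).toReal with hH
  -- The `+ 1` spares a proof that the cube boundary has positive measure.
  have hHpos : 0 < H + 1 := by positivity
  have hmeas : MeasurableSet {y : EuclideanSpace ℝ (Fin (m + 1)) |
      inner ℝ u x - t < inner ℝ u y} :=
    (isOpen_lt (by fun_prop) (by fun_prop)).measurableSet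
  have hcap : ENNReal.ofReal (capConst m r * √t ^ m) ≤
      uniformBoundary (K : Set (EuclideanSpace ℝ (Fin (m + 1))))
        {y | inner ℝ u x - t < inner ℝ u y} := by
    rw [uniformBoundary_eq, cond_apply isClosed_frontier.measurableSet]
    have h1 := hausdorffMeasure_cap_ge_sqrt hm hr hK ht htr hu hx hmax
    have h2 : Measure.hausdorffMeasure (m : ℝ)
        (frontier (K : Set (EuclideanSpace ℝ (Fin (m + 1))))) ≤ ENNReal.ofReal (H + 1) := by
      refine (hausdorffMeasure_frontier_le hK).trans ?_
      rw [← ENNReal.ofReal_toReal (hausdorffMeasure_cubeBoundary_lt_top m).ne]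
      exact ENNReal.ofReal_le_ofReal (by linarith)
    refine le_trans (le_of_eq ?_) (mul_le_mul' (ENNReal.inv_le_inv.2 h2) h1)
    rw [← ENNReal.ofReal_inv_of_pos hHpos, ← ENNReal.ofReal_mul (by positivity), capConst]
    congr 1
    rw [← hH]
    ring
  have hcompl : {y : EuclideanSpace ℝ (Fin (m + 1)) | inner ℝ u y ≤ inner ℝ u x - t} =
      {y | inner ℝ u x - t < inner ℝ u y}ᶜ := by
    ext y
    simp
  rw [hcompl, prob_compl_eq_one_sub hmeas]
  refine (tsub_le_tsub_left hcap 1).trans ?_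
  rw [← ENNReal.ofReal_one, ← ENNReal.ofReal_sub _
    (mul_nonneg (capConst_pos hm hr).le (by positivity))]
  exact ENNReal.ofReal_le_ofReal (Real.one_sub_le_exp_neg _)

theorem hausdorffDist_randomPolytope_le_two (hK : K ∈ rollingBodies r (m + 1)) {n : ℕ} [NeZero n]
    {X : Fin n → EuclideanSpace ℝ (Fin (m + 1))} (hX : ∀ i, X i ∈ K) :
    Metric.hausdorffDist (randomPolytope X) K ≤ 2 := by
  have hsub : randomPolytope X ⊆ K := convexHull_min (by rintro _ ⟨i, rfl⟩; exact hX i) K.convex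
  have hd : ∀ x ∈ K, ∀ y ∈ K, dist x y ≤ 2 := fun x hx y hy => by
    have h1 := dist_triangle_right x y 0
    have h2 := Metric.mem_closedBall.1 (hK.2.1 hx)
    have h3 := Metric.mem_closedBall.1 (hK.2.1 hy)
    linarith
  have h0 : X 0 ∈ randomPolytope X := subset_convexHull ℝ _ ⟨0, rfl⟩
  exact Metric.hausdorffDist_le_of_mem_dist zero_le_two
    (fun x hx => ⟨X 0, hX 0, hd _ (hsub hx) _ (hX 0)⟩) (fun x hx => ⟨X 0, h0, hd _ hx _ (hX 0)⟩)

theorem ae_pi_uniformBoundary_mem (hm : 0 < m) (hr : 0 < r) (hK : K ∈ rollingBodies r (m + 1))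
    (n : ℕ) : ∀ᵐ X ∂(Measure.pi fun _ : Fin n =>
      uniformBoundary (K : Set (EuclideanSpace ℝ (Fin (m + 1))))), ∀ i, X i ∈ K := by
  have := isProbabilityMeasure_uniformBoundary hm hr hK
  rw [ae_all_iff]
  exact fun i => Measure.tendsto_eval_ae_ae.eventually (ae_mem_uniformBoundary K)

theorem boundaryMoment_le_two_rpow (hm : 0 < m) (hr : 0 < r) (hK : K ∈ rollingBodies r (m + 1))
    (n : ℕ) [NeZero n] {q : ℝ} (hq : 0 ≤ q) :
    boundaryMoment (K : Set (EuclideanSpace ℝ (Fin (m + 1)))) n q ≤ ENNReal.ofReal (2 ^ q) := by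
  have := isProbabilityMeasure_uniformBoundary hm hr hK
  rw [boundaryMoment]
  refine (lintegral_mono_ae (g := fun _ => ENNReal.ofReal (2 ^ q)) ?_).trans (by simp)
  filter_upwards [ae_pi_uniformBoundary_mem hm hr hK n] with X hX
  exact ENNReal.ofReal_le_ofReal (Real.rpow_le_rpow Metric.hausdorffDist_nonneg
    (hausdorffDist_randomPolytope_le_two hK hX) hq)

theorem boundaryMoment_le (hm : 0 < m) (hr : 0 < r) (hK : K ∈ rollingBodies r (m + 1))
    (n : ℕ) [NeZero n] {q : ℝ} (hq : 0 ≤ q) {t : ℝ} (ht : 0 < t) (htr : t ≤ 2 * r)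
    {M : ℕ} (hM : 0 < M) (hMt : ((m + 1 : ℕ) : ℝ) / M ≤ t / 4) :
    boundaryMoment (K : Set (EuclideanSpace ℝ (Fin (m + 1)))) n q ≤
      ENNReal.ofReal (t ^ q + 2 ^ q * ((2 * M + 1) ^ (m + 1) *
        Real.exp (-(capConst m r * √(t / 2) ^ m)) ^ n)) := by
  have := isProbabilityMeasure_uniformBoundary hm hr hK
  obtain ⟨s, hscard, hs1, hsnet⟩ := exists_finset_net_sphere (m + 1) M m.succ_pos hM
  choose x hxK hxmax using exists_inner_max K
  let A : EuclideanSpace ℝ (Fin (m + 1)) → Set (EuclideanSpace ℝ (Fin (m + 1))) :=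
    -- Replacing a direction by a net point costs `t / 4` at the sample point and `t / 4` at the
    -- tip, since `K` lies in the unit ball; depth `t / 2` remains.
    fun v => {y | inner ℝ v y ≤ inner ℝ v (x v) - t / 2}
  let U : Set (Fin n → EuclideanSpace ℝ (Fin (m + 1))) :=
    ⋃ v ∈ s, Set.pi Set.univ fun _ => A v
  have hA : ∀ v, MeasurableSet (A v) := fun v =>
    (isClosed_le (by fun_prop) (by fun_prop)).measurableSet
  have hU : MeasurableSet U := s.measurableSet_biUnion fun v _ =>
    MeasurableSet.univ_pi fun _ => hA v
  set P := Measure.pi fun _ : Fin n =>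
    uniformBoundary (K : Set (EuclideanSpace ℝ (Fin (m + 1)))) with hP
  set ε := Real.exp (-(capConst m r * √(t / 2) ^ m))
  have hPU : P U ≤ ENNReal.ofReal ((2 * M + 1) ^ (m + 1) * ε ^ n) := by
    calc P U ≤ ∑ v ∈ s, P (Set.pi Set.univ fun _ => A v) := measure_biUnion_finset_le _ _
      _ ≤ ∑ _v ∈ s, ENNReal.ofReal (ε ^ n) := by
        refine Finset.sum_le_sum fun v hv => ?_
        rw [hP, Measure.pi_pi, Finset.prod_const, Finset.card_univ, Fintype.card_fin,
          ENNReal.ofReal_pow (Real.exp_pos _).le]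
        gcongr
        exact uniformBoundary_cap_compl_le hm hr hK (by positivity) (by linarith) (hs1 v hv)
          (hxK v) (hxmax v)
      _ ≤ ENNReal.ofReal ((2 * M + 1) ^ (m + 1) * ε ^ n) := by
        rw [Finset.sum_const, nsmul_eq_mul, ENNReal.ofReal_mul (by positivity)]
        gcongr
        rw [← ENNReal.ofReal_natCast]
        exact ENNReal.ofReal_le_ofReal (by exact_mod_cast hscard)
  rw [boundaryMoment, ← hP]
  calc ∫⁻ X, ENNReal.ofReal (Metric.hausdorffDist (randomPolytope X) K ^ q) ∂P
      ≤ ∫⁻ X, (ENNReal.ofReal (t ^ q) + U.indicator (fun _ => ENNReal.ofReal (2 ^ q)) X) ∂P := by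
        refine lintegral_mono_ae ?_
        filter_upwards [ae_pi_uniformBoundary_mem hm hr hK n] with X hX
        rcases le_or_gt (Metric.hausdorffDist (randomPolytope X) K) t with hle | hlt
        · exact (ENNReal.ofReal_le_ofReal (Real.rpow_le_rpow Metric.hausdorffDist_nonneg
            hle hq)).trans le_self_add
        · have hXU : X ∈ U := by
            obtain ⟨u, hu, z, hz, hcap⟩ := exists_cap_of_lt_hausdorffDist K.convex ht.le hX hlt
            obtain ⟨v, hv, huv⟩ := hsnet u hu
            refine Set.mem_biUnion hv fun i _ => ?_
            have hin : ∀ y ∈ K, |inner ℝ u y - inner ℝ v y| ≤ t / 4 := fun y hy => by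
              rw [← inner_sub_left]
              refine (abs_real_inner_le_norm _ _).trans ?_
              have := mem_closedBall_zero_iff.1 (hK.2.1 hy)
              nlinarith [norm_nonneg (u - v), norm_nonneg y]
            have h1 := abs_le.1 (hin _ (hX i))
            have h2 := abs_le.1 (hin z hz)
            have h3 := hxmax v z hz
            have h4 := hcap i
            change inner ℝ v (X i) ≤ inner ℝ v (x v) - t / 2
            linarith [h1.1, h2.2]
          rw [Set.indicator_of_mem hXU]
          exact (ENNReal.ofReal_le_ofReal (Real.rpow_le_rpow Metric.hausdorffDist_nonneg
            (hausdorffDist_randomPolytope_le_two hK hX) hq)).trans le_add_self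
    _ = ENNReal.ofReal (t ^ q) + ENNReal.ofReal (2 ^ q) * P U := by
        rw [lintegral_add_left measurable_const, lintegral_indicator_const hU]
        simp [hP]
    _ ≤ _ := by
        rw [ENNReal.ofReal_add (by positivity) (by positivity),
          ENNReal.ofReal_mul (p := 2 ^ q) (by positivity)]
        gcongr

end rollingBodies

/-! ### Choice of the depth and conclusion. -/

/-- The net parameter is `M = 16 (m + 1) n ^ 2`. The factor `n ^ (2 (m + 1))` from the size of the
net is cancelled by the choice of `B`, which leaves `n ^ (-2 q)`. -/
theorem rate_bounds {m n : ℕ} (hm : 0 < m) (hn : 2 ≤ n) {a B q : ℝ} (ha : 0 < a) (hq : 0 ≤ q)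
    (hB : 1 ≤ B) (hBa : √2 ^ m * (2 * (m + 1) + 2 * q) ≤ a * B) {t : ℝ}
    (ht : t = (B * (Real.log n / n)) ^ (2 / (m : ℝ))) :
    0 < t ∧ ((m + 1 : ℕ) : ℝ) / ((16 * (m + 1) * n ^ 2 : ℕ) : ℝ) ≤ t / 4 ∧
    t ^ q = B ^ (2 * q / m) * (Real.log n / n) ^ (2 * q / m) ∧
    (2 * ((16 * (m + 1) * n ^ 2 : ℕ) : ℝ) + 1) ^ (m + 1) * Real.exp (-(a * √(t / 2) ^ m)) ^ n ≤
      (48 * (m + 1)) ^ (m + 1) * 2 ^ (2 * q / m) * (Real.log n / n) ^ (2 * q / m) := by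
  have hm1 : (1 : ℝ) ≤ m := by exact_mod_cast hm
  have hn2 : (2 : ℝ) ≤ n := by exact_mod_cast hn
  have hn0 : (0 : ℝ) < n := by linarith
  have hlog : 1 / 2 ≤ Real.log n := by
    have := Real.log_le_log two_pos hn2
    linarith [Real.log_two_gt_d9]
  set L := Real.log n / n with hL
  have hLn : 1 / (2 * n : ℝ) ≤ L := by
    rw [hL, div_le_div_iff₀ (by positivity) hn0]
    nlinarith
  have hL0 : 0 < L := lt_of_lt_of_le (by positivity) hLn
  have he : 2 / (m : ℝ) ≤ 2 := by rw [div_le_iff₀ (by linarith)]; linarith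
  have hBL : 0 < B * L := by positivity
  have ht0 : 0 < t := ht ▸ Real.rpow_pos_of_pos hBL _
  have hrec : (1 / (2 * n : ℝ)) ≤ 1 := by rw [div_le_one (by positivity)]; linarith
  refine ⟨ht0, ?_, ?_, ?_⟩
  -- Since `2 / m ≤ 2` and `B * L ≥ 1 / (2 n)`, `t` decays no faster than `n ^ (-2)`; this is why
  -- `M` is quadratic in `n`.
  · have h1 : (1 / (2 * n : ℝ)) ^ 2 ≤ t := by
      rw [ht, ← Real.rpow_two]
      refine (Real.rpow_le_rpow_of_exponent_ge (by positivity) hrec he).trans ?_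
      refine Real.rpow_le_rpow (by positivity) ?_ (by positivity)
      nlinarith
    have h2 : ((m + 1 : ℕ) : ℝ) / ((16 * (m + 1) * n ^ 2 : ℕ) : ℝ) = (1 / (2 * n : ℝ)) ^ 2 / 4 := by
      push_cast
      field_simp
      norm_num
    rw [h2]
    linarith
  · rw [ht, ← Real.rpow_mul hBL.le, Real.mul_rpow (by linarith) hL0.le]
    congr 2 <;> ring
  · have hsqrt : √(t / 2) ^ m = B * L / √2 ^ m := by
      rw [Real.sqrt_div ht0.le, div_pow, ht, Real.sqrt_eq_rpow, ← Real.rpow_mul hBL.le,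
        ← Real.rpow_natCast ((B * L) ^ _), ← Real.rpow_mul hBL.le]
      congr 1
      rw [show 2 / (m : ℝ) * (1 / 2) * m = 1 by field_simp, Real.rpow_one]
    have hexp : Real.exp (-(a * √(t / 2) ^ m)) ^ n ≤ (n : ℝ) ^ (-(2 * ((m : ℝ) + 1) + 2 * q)) := by
      rw [← Real.exp_nat_mul, Real.rpow_def_of_pos hn0, Real.exp_le_exp, hsqrt]
      have h1 : (n : ℝ) * -(a * (B * L / √2 ^ m)) = -(Real.log n * (a * B / √2 ^ m)) := by
        rw [hL]
        field_simp
      have h2 : 2 * ((m : ℝ) + 1) + 2 * q ≤ a * B / √2 ^ m := by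
        rw [le_div_iff₀ (by positivity)]
        linarith
      rw [h1, mul_neg, neg_le_neg_iff]
      exact mul_le_mul_of_nonneg_left h2 (by linarith)
    have hpoly : (2 * ((16 * (m + 1) * n ^ 2 : ℕ) : ℝ) + 1) ^ (m + 1) ≤
        (48 * (m + 1)) ^ (m + 1) * (n : ℝ) ^ (2 * ((m : ℝ) + 1)) := by
      have h1 : (n : ℝ) ^ (2 * ((m : ℝ) + 1)) = ((n : ℝ) ^ 2) ^ (m + 1) := by
        rw [← pow_mul, ← Real.rpow_natCast]
        push_cast
        rfl
      rw [h1, ← mul_pow]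
      refine pow_le_pow_left₀ (by positivity) ?_ _
      push_cast
      nlinarith [mul_le_mul (show (1 : ℝ) ≤ m + 1 by linarith) (show (1 : ℝ) ≤ n ^ 2 by nlinarith)
        zero_le_one (by linarith)]
    have hneg : (n : ℝ) ^ (-(2 * q)) ≤ 2 ^ (2 * q / m) * L ^ (2 * q / m) := by
      rw [← Real.mul_rpow zero_le_two hL0.le]
      calc (n : ℝ) ^ (-(2 * q)) ≤ (n : ℝ) ^ (-(2 * q / m)) := by
            refine Real.rpow_le_rpow_of_exponent_le (by linarith) ?_
            rw [neg_le_neg_iff]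
            exact div_le_self (by linarith) hm1
        _ = (1 / n : ℝ) ^ (2 * q / m) := by
            rw [Real.rpow_neg hn0.le, one_div, Real.inv_rpow hn0.le]
        _ ≤ (2 * L) ^ (2 * q / m) := by
            refine Real.rpow_le_rpow (by positivity) ?_ (by positivity)
            have : 1 / (n : ℝ) = 2 * (1 / (2 * n)) := by field_simp
            linarith
    calc _ ≤ (48 * ((m : ℝ) + 1)) ^ (m + 1) * (n : ℝ) ^ (2 * ((m : ℝ) + 1)) *
          (n : ℝ) ^ (-(2 * ((m : ℝ) + 1) + 2 * q)) := by gcongr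
      _ = (48 * ((m : ℝ) + 1)) ^ (m + 1) * (n : ℝ) ^ (-(2 * q)) := by
          rw [mul_assoc, ← Real.rpow_add hn0]
          congr 2
          ring
      _ ≤ (48 * ((m : ℝ) + 1)) ^ (m + 1) * (2 ^ (2 * q / m) * L ^ (2 * q / m)) := by gcongr
      _ = _ := by ring

theorem mainTheorem11 (d : ℕ) (hd : 2 ≤ d) (r : ℝ) (hr0 : 0 < r) (hr1 : r ≤ 1)
    (q : ℝ) (hq : 1 ≤ q) :
    (∀ K ∈ rollingBodies r d,
      IsProbabilityMeasure (uniformBoundary (K : Set (EuclideanSpace ℝ (Fin d))))) ∧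
    ∃ C : ℝ, 0 < C ∧ ∀ n : ℕ, 2 ≤ n →
      (⨆ K ∈ rollingBodies r d, boundaryMoment (K : Set (EuclideanSpace ℝ (Fin d))) n q) ≤
        ENNReal.ofReal (C * (Real.log n / n) ^ (2 * q / ((d : ℝ) - 1))) := by
  obtain ⟨m, rfl⟩ : ∃ m, d = m + 1 := ⟨d - 1, by omega⟩
  have hm : 0 < m := by omega
  have hq0 : 0 ≤ q := by linarith
  refine ⟨fun K hK => isProbabilityMeasure_uniformBoundary hm hr0 hK, ?_⟩
  have ha := capConst_pos hm hr0
  set a := capConst m r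
  set B : ℝ := 1 + √2 ^ m * (2 * (m + 1) + 2 * q) / a with hB
  have hB1 : 1 ≤ B := le_add_of_nonneg_right (by positivity)
  have hBa : √2 ^ m * (2 * (m + 1) + 2 * q) ≤ a * B := by
    rw [hB, mul_add a, mul_div_cancel₀ _ ha.ne']
    exact le_add_of_nonneg_left (by positivity)
  have hB0 : 0 < B := by linarith
  have hcast : (((m + 1 : ℕ) : ℝ) - 1) = m := by push_cast; ring
  rw [hcast]
  refine ⟨B ^ (2 * q / m) + 2 ^ q * ((48 * (m + 1)) ^ (m + 1) * 2 ^ (2 * q / m)) +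
    (r ^ q)⁻¹ * B ^ (2 * q / m), by positivity, fun n hn => iSup₂_le fun K hK => ?_⟩
  have : NeZero n := ⟨by omega⟩
  obtain ⟨ht, hMt, htq, hprob⟩ := rate_bounds hm hn ha hq0 hB1 hBa rfl
  set t := (B * (Real.log n / n)) ^ (2 / (m : ℝ))
  have hL : 0 ≤ (Real.log n / n) ^ (2 * q / (m : ℝ)) :=
    Real.rpow_nonneg (div_nonneg (Real.log_natCast_nonneg n) n.cast_nonneg) _
  rcases le_or_gt t (2 * r) with htr | htr
  · refine (boundaryMoment_le hm hr0 hK n hq0 ht htr (by positivity) hMt).trans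
      (ENNReal.ofReal_le_ofReal ?_)
    rw [htq, add_mul, add_mul, mul_assoc (2 ^ q)]
    have h1 : 0 ≤ (r ^ q)⁻¹ * B ^ (2 * q / m) * (Real.log n / n) ^ (2 * q / (m : ℝ)) := by
      positivity
    have h2 := mul_le_mul_of_nonneg_left hprob (show (0 : ℝ) ≤ 2 ^ q by positivity)
    linarith
  -- Here the cap estimate is unavailable, but the trivial bound 2 is below `t / r`, which is what
  -- the last term of the constant absorbs.
  · refine (boundaryMoment_le_two_rpow hm hr0 hK n hq0).trans (ENNReal.ofReal_le_ofReal ?_)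
    have h1 : (2 : ℝ) ^ q ≤ (r ^ q)⁻¹ * t ^ q := by
      rw [← Real.inv_rpow hr0.le, ← Real.mul_rpow (by positivity) ht.le]
      refine Real.rpow_le_rpow zero_le_two ?_ hq0
      rw [← div_eq_inv_mul, le_div_iff₀ hr0]
      exact htr.le
    rw [htq] at h1
    rw [add_mul, mul_assoc (r ^ q)⁻¹]
    have h2 : 0 ≤ (B ^ (2 * q / m) + 2 ^ q * ((48 * (m + 1)) ^ (m + 1) * 2 ^ (2 * q / m))) *
      (Real.log n / n) ^ (2 * q / (m : ℝ)) := by positivity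
    linarith
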